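/- Let $n\ge 1$, let $\mathbb F_n^+$ be the free unital semigroup on generators $g_1,\dots,g_n$ with identity $g_0$, and let $|\alpha|$ be the length of $\alpha\in\mathbb F_n^+$. For operators $T_1,\dots,T_n$ put $T_\alpha=T_{i_1}\cdots T_{i_k}$ if $\alpha=g_{i_1}\cdots g_{i_k}$, and $T_{g_0}=I$. Hilbert spaces are complex, $\otimes$ is the Hilbert space tensor product, and $S_1,\dots,S_n$ are the left creation operators $S_i\varphi=e_i\otimes\varphi$ on the full Fock space $F^2(H_n)=\bigoplus_{k\ge 0}H_n^{\otimes k}$, where $H_n$ is a Hilbert space with orthonormal basis $e_1,\dots,e_n$. Let $\mathcal H$ be a Hilbert space and let $\{A_{(\alpha)}\}_{\alpha\in\mathbb F_n^+}\subset B(\mathcal H)$ be such that for every Hilbert space $\mathcal X$ and every $(X_1,\dots,X_n)\in B(\mathcal X)^n$ with $\|X_1X_1^*+\cdots+X_nX_n^*\|<1$ the series $$F(X_1,\dots,X_n)=\sum_{k=0}^\infty\ \sum_{|\alpha|=k}X_\alpha\otimes A_{(\alpha)}$$ converges in the operator norm (that is, the partial sums over $k$ converge). Write $A_{(0)}=A_{(g_0)}$.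 Suppose that $F(0)\ge 0$ and that $\operatorname{Re}F(X_1,\dots,X_n)\le I$ for all such $\mathcal X$ and $(X_1,\dots,X_n)$. Then: (i) For every $k\ge 1$ the operator matrix $$P_k=\begin{pmatrix}2(I-A_{(0)}) & [A_{(\alpha)}^*:|\alpha|=k]\\ \left[\begin{matrix}A_{(\alpha)}\\ \vdots\\ |\alpha|=k\end{matrix}\right] & \operatorname{diag}\bigl(2(I-A_{(0)}),\dots,2(I-A_{(0)})\bigr)\end{pmatrix},$$ acting on the direct sum of $1+n^k$ copies of $\mathcal H$, is positive. (ii) If $\mathcal K$ is a Hilbert space and $\{Y_{(\alpha)}\}_{\alpha\in\mathbb F_n^+}\subset B(\mathcal K)$ satisfies $$\|Y_{(g_0)}\|\le 1\quad\text{and}\quad \sum_{k=1}^\infty\Bigl\|\sum_{|\alpha|=k}Y_{(\alpha)}^*Y_{(\alpha)}\Bigr\|^{1/2}\le\frac12,$$ then the series $\sum_{k=0}^\infty\sum_{|\alpha|=k}S_\alpha\otimes A_{(\alpha)}\otimes Y_{(\alpha)}$ converges in the norm of $B(F^2(H_n)\otimes\mathcal H\otimes\mathcal K)$, and $$\Bigl\|\sum_{k=0}^\infty\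 \sum_{|\alpha|=k}S_\alpha\otimes A_{(\alpha)}\otimes Y_{(\alpha)}\Bigr\|\le 1.$$ -/

import Mathlib

open Filter Topology
open scoped TensorProduct

universe w u v

noncomputable section

namespace FreeHolo

/-- The Hilbert space tensor product: the completion of the algebraic tensor product with the inner
product `⟪x ⊗ y, x' ⊗ y'⟫ = ⟪x, x'⟫ * ⟪y, y'⟫`. -/
abbrev HTensor (E F : Type*) [NormedAddCommGroup E] [InnerProductSpace ℂ E]
    [NormedAddCommGroup F] [InnerProductSpace ℂ F] : Type _ :=
  UniformSpace.Completion (E ⊗[ℂ] F)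

/-- The tensor product `T ⊗ A` of bounded operators, acting on the Hilbert tensor product. -/
def opTensor {E F : Type*} [NormedAddCommGroup E] [InnerProductSpace ℂ E]
    [NormedAddCommGroup F] [InnerProductSpace ℂ F] (T : E →L[ℂ] E) (A : F →L[ℂ] F) :
    HTensor E F →L[ℂ] HTensor E F :=
  (TensorProduct.mapL T A).completion

theorem opTensor_tmul {E F : Type*} [NormedAddCommGroup E] [InnerProductSpace ℂ E]
    [NormedAddCommGroup F] [InnerProductSpace ℂ F] (T : E →L[ℂ] E) (A : F →L[ℂ] F)
    (x : E) (y : F) :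
    opTensor T A ((x ⊗ₜ[ℂ] y : E ⊗[ℂ] F) : HTensor E F)
      = ((T x ⊗ₜ[ℂ] A y : E ⊗[ℂ] F) : HTensor E F) := by
  simp [opTensor]

/-- The free semigroup `𝔽ₙ⁺` on `n` generators; its identity `g₀` is `1`, and the length `|α|` is
`FreeMonoid.length`. -/
abbrev Words (n : ℕ) : Type := FreeMonoid (Fin n)

instance instDecidableEqWords (n : ℕ) : DecidableEq (Words n) :=
  inferInstanceAs (DecidableEq (List (Fin n)))

/-- The finite set of the words `α` with `|α| = k`. -/
def wordsOfLength (n k : ℕ) : Finset (Words n) :=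
  Finset.univ.map ⟨fun v : List.Vector (Fin n) k => FreeMonoid.ofList v.toList,
    fun _ _ h => Subtype.ext h⟩

theorem mem_wordsOfLength {n k : ℕ} {α : Words n} : α ∈ wordsOfLength n k ↔ α.length = k := by
  simp only [wordsOfLength, Finset.mem_map, Finset.mem_univ, true_and]
  constructor
  · rintro ⟨v, rfl⟩
    exact v.2
  · intro h
    exact ⟨⟨FreeMonoid.toList α, h⟩, rfl⟩

/-- The product `T_α = T_{i₁} T_{i₂} ⋯ T_{iₖ}` for `α = g_{i₁} g_{i₂} ⋯ g_{iₖ}`, with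
`T_{g₀} = I`. -/
def wordProd {n : ℕ} {X : Type*} [NormedAddCommGroup X] [InnerProductSpace ℂ X]
    (T : Fin n → X →L[ℂ] X) (α : Words n) : X →L[ℂ] X :=
  FreeMonoid.lift T α

/-- The full Fock space `F²(Hₙ)` of an `n`-dimensional Hilbert space with orthonormal basis
`e₁, …, eₙ`, in the coordinates given by the orthonormal basis
`e_α = e_{i₁} ⊗ ⋯ ⊗ e_{iₖ}`, `α = g_{i₁} ⋯ g_{iₖ} ∈ 𝔽ₙ⁺`. -/
abbrev Fock (n : ℕ) : Type := lp (fun _ : Words n => ℂ) 2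

/-- The basis vector `e_α` of the full Fock space. -/
def fockBasis {n : ℕ} (α : Words n) : Fock n := lp.single 2 α (1 : ℂ)

theorem orthonormal_fockBasis (n : ℕ) : Orthonormal ℂ (fockBasis (n := n)) := by
  rw [orthonormal_iff_ite]
  intro α β
  simp only [fockBasis]
  rw [lp.inner_single_left]
  by_cases h : α = β
  · subst h; simp
  · simp [h]

theorem orthonormal_fockBasis_mul {n : ℕ} (i : Fin n) :
    Orthonormal ℂ (fun β : Words n => fockBasis (FreeMonoid.of i * β)) :=
  (orthonormal_fockBasis n).comp _ (mul_right_injective _)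

/-- The left creation operator `S_i φ = e_i ⊗ φ` on the full Fock space, i.e. the isometry
`∑ φ_β e_β ↦ ∑ φ_β e_{g_i β}`. -/
def leftCreation {n : ℕ} (i : Fin n) : Fock n →L[ℂ] Fock n :=
  ((orthonormal_fockBasis_mul i).orthogonalFamily.linearIsometry).toContinuousLinearMap

theorem leftCreation_fockBasis {n : ℕ} (i : Fin n) (β : Words n) :
    leftCreation i (fockBasis β) = fockBasis (FreeMonoid.of i * β) := by
  simp [leftCreation, fockBasis, OrthogonalFamily.linearIsometry_apply_single]

/-- The partial sum `∑_{k < m} ∑_{|α| = k} X_α ⊗ A_(α)`. -/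
def partialSum {n : ℕ} {H : Type*} [NormedAddCommGroup H] [InnerProductSpace ℂ H]
    (A : Words n → H →L[ℂ] H) {X : Type*} [NormedAddCommGroup X] [InnerProductSpace ℂ X]
    (T : Fin n → X →L[ℂ] X) (m : ℕ) : HTensor X H →L[ℂ] HTensor X H :=
  ∑ k ∈ Finset.range m, ∑ α ∈ wordsOfLength n k, opTensor (wordProd T α) (A α)

/-- `T ∈ [B(X)ⁿ]_{<1}`, the open unit ball `‖X₁X₁* + ⋯ + XₙXₙ*‖ < 1`. -/
def InBall {n : ℕ} {X : Type*} [NormedAddCommGroup X] [InnerProductSpace ℂ X] [CompleteSpace X]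
    (T : Fin n → X →L[ℂ] X) : Prop :=
  ‖∑ i, T i * star (T i)‖ < 1

/-- The coefficients `A_(α)` define a (universal) holomorphic function on `[B(X)ⁿ]_{<1}`: for every
Hilbert space `X` and every tuple in the ball, the series
`∑_k ∑_{|α| = k} X_α ⊗ A_(α)` converges in the operator norm. -/
def IsHolomorphic {n : ℕ} {H : Type u} [NormedAddCommGroup H] [InnerProductSpace ℂ H]
    (A : Words n → H →L[ℂ] H) : Prop :=
  ∀ (X : Type w) [NormedAddCommGroup X] [InnerProductSpace ℂ X] [CompleteSpace X]
    (T : Fin n → X →L[ℂ] X), InBall T →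
      ∃ L : HTensor X H →L[ℂ] HTensor X H, Tendsto (partialSum A T) atTop (𝓝 L)

/-- The value `F(X₁, …, Xₙ) = ∑_k ∑_{|α| = k} X_α ⊗ A_(α)`, the operator norm limit of the partial
sums (meaningful where the series converges). -/
def eval {n : ℕ} {H : Type*} [NormedAddCommGroup H] [InnerProductSpace ℂ H]
    (A : Words n → H →L[ℂ] H) {X : Type*} [NormedAddCommGroup X] [InnerProductSpace ℂ X]
    (T : Fin n → X →L[ℂ] X) : HTensor X H →L[ℂ] HTensor X H :=
  limUnder atTop (partialSum A T)

theorem IsHolomorphic.tendsto_eval {n : ℕ} {H : Type u} [NormedAddCommGroup H]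
    [InnerProductSpace ℂ H] {A : Words n → H →L[ℂ] H} (hA : IsHolomorphic.{w} A)
    (X : Type w) [NormedAddCommGroup X] [InnerProductSpace ℂ X] [CompleteSpace X]
    (T : Fin n → X →L[ℂ] X) (hT : InBall T) :
    Tendsto (partialSum A T) atTop (𝓝 (eval A T)) :=
  tendsto_nhds_limUnder (hA X T hT)

/-- The operator on the Hilbert direct sum `⨁_{i ∈ ι} H` given by an operator matrix:
`(M x)_i = ∑_j M_{ij} x_j`. -/
def blockOp {ι : Type*} [Fintype ι] {H : Type*} [NormedAddCommGroup H] [InnerProductSpace ℂ H]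
    (M : Matrix ι ι (H →L[ℂ] H)) :
    PiLp 2 (fun _ : ι => H) →L[ℂ] PiLp 2 (fun _ : ι => H) :=
  (PiLp.continuousLinearEquiv 2 ℂ (fun _ : ι => H)).symm.toContinuousLinearMap ∘L
    ContinuousLinearMap.pi fun i => ∑ j, M i j ∘L PiLp.proj 2 (fun _ : ι => H) j

theorem blockOp_apply {ι : Type*} [Fintype ι] {H : Type*} [NormedAddCommGroup H]
    [InnerProductSpace ℂ H] (M : Matrix ι ι (H →L[ℂ] H)) (x : PiLp 2 (fun _ : ι => H)) (i : ι) :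
    blockOp M x i = ∑ j, M i j (x j) := by
  simp [blockOp]

/-- The operator matrix `P_k`: diagonal entries `2(I - A_(0))`, first row
`[A_(α)* : |α| = k]`, first column `[A_(α) : |α| = k]`, all other entries `0`. -/
def matP {n : ℕ} {H : Type*} [NormedAddCommGroup H] [InnerProductSpace ℂ H] [CompleteSpace H]
    (A : Words n → H →L[ℂ] H) (k : ℕ) :
    Matrix (Unit ⊕ wordsOfLength n k) (Unit ⊕ wordsOfLength n k) (H →L[ℂ] H) :=
  Matrix.fromBlocks
    (Matrix.of fun _ _ => (2 : ℂ) • (1 - A 1))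
    (Matrix.of fun _ α => star (A α))
    (Matrix.of fun α _ => A α)
    (Matrix.of fun α β => if α = β then (2 : ℂ) • (1 - A 1) else 0)

end FreeHolo

end

/-!
For `X = (r S₁, …, r Sₙ)`, the compression of `2 I - 2 Re F(X)` to the span of the vacuum and the
words of length `k` is, up to the sign of the latter, the matrix `P_k` of the coefficients
`r ^ |α| A_(α)`; letting `r → 1` gives `P_k ≥ 0`.

Put `Δ = 2 (I - A_(0))`. Positivity of `P_k` says that every `A_(α)` is dominated by `Δ`, that is,
`A_(α) = Δ^{1/2} G_α Δ^{1/2}` with `‖G_α‖ ≤ 1` after a perturbation making `Δ` invertible. The `S_α`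
with `|α| = k` are isometries with orthogonal ranges, so the `k`-th homogeneous part of the series
is dominated by `‖∑ Y_(α)* Y_(α)‖^{1/2} (I ⊗ Δ ⊗ I)`, while its constant term is dominated by
`I ⊗ A_(0) ⊗ I`. The sum is therefore dominated by `I ⊗ (A_(0) + Δ / 2) ⊗ I = I`.
-/

noncomputable section

namespace FreeHolo

section StarAlgebra

variable {R : Type*}

theorem two_smul_one_sub_nonneg_of_realPart_le_one [AddCommGroupWithOne R] [Module ℂ R]
    [StarAddMonoid R] [StarModule ℂ R] [PartialOrder R] [IsOrderedAddMonoid R] {a : R}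
    (ha : (realPart a : R) ≤ 1) : 0 ≤ (2 : ℂ) • 1 - (a + star a) := by
  have hsum : (2 : ℂ) • 1 - (a + star a) = (1 - (realPart a : R)) + (1 - realPart a) := by
    rw [realPart_apply_coe]
    module
  rw [hsum]
  exact add_nonneg (sub_nonneg.mpr ha) (sub_nonneg.mpr ha)

variable [CStarAlgebra R]

theorem norm_sum_mul_star_le_one {ι : Type*} [Fintype ι] [DecidableEq ι]
    {V : ι → R} (hV : ∀ i j, star (V i) * V j = if i = j then 1 else 0) :
    ‖∑ i, V i * star (V i)‖ ≤ 1 := by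
  have hproj : IsStarProjection (∑ i, V i * star (V i)) := by
    refine ⟨?_, by simp [IsSelfAdjoint]⟩
    have hmul (i j : ι) :
        V i * star (V i) * (V j * star (V j)) = if i = j then V i * star (V i) else 0 := by
      rw [mul_assoc, ← mul_assoc (star (V i)), hV]
      split_ifs with h <;> simp [h]
    simp only [IsIdempotentElem, Finset.sum_mul, Finset.mul_sum, hmul]
    simp
  exact hproj.norm_le

variable [PartialOrder R] [StarOrderedRing R]

theorem smul_one_nonneg {ε : ℝ} (hε : 0 ≤ ε) : 0 ≤ (ε : ℂ) • (1 : R) := by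
  rw [Complex.coe_smul]
  exact smul_nonneg hε zero_le_one

theorem isUnit_add_smul_one {b : R} (hb : 0 ≤ b) {ε : ℝ} (hε : 0 < ε) :
    IsUnit (b + (ε : ℂ) • 1) := by
  refine CStarAlgebra.isUnit_of_le ((ε : ℂ) • (1 : R)) (le_add_of_nonneg_left hb) ?_
  refine IsStrictlyPositive.iff_of_unital.mpr ⟨smul_one_nonneg hε.le, ?_⟩
  exact (isUnit_one (M := R)).smul (Units.mk0 (ε : ℂ) (by exact_mod_cast hε.ne'))

end StarAlgebra

section TensorProducts

variable {E F G : Type*} [NormedAddCommGroup E] [InnerProductSpace ℂ E]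
  [NormedAddCommGroup F] [InnerProductSpace ℂ F] [NormedAddCommGroup G] [NormedSpace ℂ G]

theorem HTensor.clm_ext {S T : HTensor E F →L[ℂ] G}
    (h : ∀ (x : E) (y : F), S ((x ⊗ₜ[ℂ] y : E ⊗[ℂ] F) : HTensor E F)
      = T ((x ⊗ₜ[ℂ] y : E ⊗[ℂ] F) : HTensor E F)) : S = T := by
  ext z
  induction z using UniformSpace.Completion.induction_on with
  | hp => exact isClosed_eq S.continuous T.continuous
  | ih z =>
    induction z using TensorProduct.induction_on with
    | zero => rw [UniformSpace.Completion.coe_zero, map_zero, map_zero]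
    | tmul x y => exact h x y
    | add a b ha hb => rw [UniformSpace.Completion.coe_add, map_add, map_add, ha, hb]

theorem inner_coe_tmul (x x' : E) (y y' : F) :
    inner ℂ ((x ⊗ₜ[ℂ] y : E ⊗[ℂ] F) : HTensor E F) ((x' ⊗ₜ[ℂ] y' : E ⊗[ℂ] F) : HTensor E F)
      = inner ℂ x x' * inner ℂ y y' := by
  rw [UniformSpace.Completion.inner_coe, TensorProduct.inner_tmul]

theorem opTensor_mul (S T : E →L[ℂ] E) (A B : F →L[ℂ] F) :
    opTensor (S * T) (A * B) = opTensor S A * opTensor T B :=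
  HTensor.clm_ext fun x y => by simp [opTensor_tmul]

theorem opTensor_one : opTensor (1 : E →L[ℂ] E) (1 : F →L[ℂ] F) = 1 :=
  HTensor.clm_ext fun x y => by simp [opTensor_tmul]

theorem opTensor_add_left (S T : E →L[ℂ] E) (A : F →L[ℂ] F) :
    opTensor (S + T) A = opTensor S A + opTensor T A :=
  HTensor.clm_ext fun x y => by
    simp [opTensor_tmul, TensorProduct.add_tmul, UniformSpace.Completion.coe_add]

theorem opTensor_add_right (S : E →L[ℂ] E) (A B : F →L[ℂ] F) :
    opTensor S (A + B) = opTensor S A + opTensor S B :=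
  HTensor.clm_ext fun x y => by
    simp [opTensor_tmul, TensorProduct.tmul_add, UniformSpace.Completion.coe_add]

theorem opTensor_smul_left (c : ℂ) (S : E →L[ℂ] E) (A : F →L[ℂ] F) :
    opTensor (c • S) A = c • opTensor S A :=
  HTensor.clm_ext fun x y => by
    simp [opTensor_tmul, ← TensorProduct.smul_tmul', UniformSpace.Completion.coe_smul]

theorem opTensor_smul_right (c : ℂ) (S : E →L[ℂ] E) (A : F →L[ℂ] F) :
    opTensor S (c • A) = c • opTensor S A :=
  HTensor.clm_ext fun x y => by simp [opTensor_tmul, UniformSpace.Completion.coe_smul]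

theorem opTensor_zero_left (A : F →L[ℂ] F) : opTensor (0 : E →L[ℂ] E) A = 0 := by
  simpa using opTensor_smul_left 0 (0 : E →L[ℂ] E) A

theorem opTensor_zero_right (S : E →L[ℂ] E) : opTensor S (0 : F →L[ℂ] F) = 0 := by
  simpa using opTensor_smul_right 0 S (0 : F →L[ℂ] F)

/-- The operator `y ↦ x ⊗ y`, as a function of `x`. -/
def tensorLeft : E →L[ℂ] F →L[ℂ] HTensor E F :=
  ContinuousLinearMap.compL ℂ F (E ⊗[ℂ] F) (HTensor E F) UniformSpace.Completion.toComplL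
    ∘L TensorProduct.mkL ℂ E F

theorem tensorLeft_apply (x : E) (y : F) :
    tensorLeft x y = ((x ⊗ₜ[ℂ] y : E ⊗[ℂ] F) : HTensor E F) := rfl

variable [CompleteSpace F]

/-- The slice map `L ↦ (x ⊗ ·)* L (x' ⊗ ·)`: the operator on `F` with
`⟪y, (slice x x' L) y'⟫ = ⟪x ⊗ y, L (x' ⊗ y')⟫`. -/
def slice (x x' : E) : (HTensor E F →L[ℂ] HTensor E F) →L[ℂ] F →L[ℂ] F :=
  ContinuousLinearMap.precomp F (tensorLeft x')
    ∘L ContinuousLinearMap.postcomp (HTensor E F) (tensorLeft x).adjoint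

theorem slice_apply (x x' : E) (L : HTensor E F →L[ℂ] HTensor E F) :
    slice x x' L = (tensorLeft x).adjoint ∘L L ∘L tensorLeft x' := rfl

theorem slice_opTensor (x x' : E) (T : E →L[ℂ] E) (A : F →L[ℂ] F) :
    slice x x' (opTensor T A) = inner ℂ x (T x') • A := by
  ext y
  refine ext_inner_left ℂ fun z => ?_
  rw [slice_apply, ContinuousLinearMap.comp_apply, ContinuousLinearMap.adjoint_inner_right,
    ContinuousLinearMap.comp_apply, tensorLeft_apply, tensorLeft_apply, opTensor_tmul,
    inner_coe_tmul, smul_apply, inner_smul_right]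

theorem slice_one (x x' : E) :
    slice x x' (1 : HTensor E F →L[ℂ] HTensor E F) = inner ℂ x x' • 1 := by
  rw [← opTensor_one, slice_opTensor, one_apply_eq_self]

theorem slice_star (x x' : E) (L : HTensor E F →L[ℂ] HTensor E F) :
    slice x x' (star L) = star (slice x' x L) := by
  simp only [slice_apply, ContinuousLinearMap.star_eq_adjoint, ContinuousLinearMap.adjoint_comp,
    ContinuousLinearMap.adjoint_adjoint, ContinuousLinearMap.comp_assoc]

theorem slice_neg_left (x x' : E) (L : HTensor E F →L[ℂ] HTensor E F) :
    slice (-x) x' L = -slice x x' L := by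
  simp only [slice_apply, map_neg, ContinuousLinearMap.neg_comp]

theorem slice_neg_right (x x' : E) (L : HTensor E F →L[ℂ] HTensor E F) :
    slice x (-x') L = -slice x x' L := by
  simp only [slice_apply, map_neg, ContinuousLinearMap.comp_neg]

theorem slice_two_smul_one_sub (x x' : E) (L : HTensor E F →L[ℂ] HTensor E F) :
    slice x x' ((2 : ℂ) • 1 - (L + star L))
      = (2 : ℂ) • (inner ℂ x x' • (1 : F →L[ℂ] F)) - (slice x x' L + star (slice x' x L)) := by
  rw [map_sub, map_add, map_smul, slice_one, slice_star]

theorem slice_self_nonneg (x : E) {L : HTensor E F →L[ℂ] HTensor E F} (hL : 0 ≤ L) :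
    0 ≤ slice x x L := by
  rw [ContinuousLinearMap.nonneg_iff_isPositive] at hL ⊢
  exact hL.adjoint_conj (tensorLeft x)

variable [CompleteSpace E]

theorem star_opTensor (S : E →L[ℂ] E) (A : F →L[ℂ] F) :
    star (opTensor S A) = opTensor (star S) (star A) := by
  refine HTensor.clm_ext fun x y => ext_inner_right ℂ fun z => ?_
  rw [ContinuousLinearMap.star_eq_adjoint, ContinuousLinearMap.adjoint_inner_left]
  have key : innerSL ℂ ((x ⊗ₜ[ℂ] y : E ⊗[ℂ] F) : HTensor E F) ∘L opTensor S A
      = innerSL ℂ (opTensor (star S) (star A) ((x ⊗ₜ[ℂ] y : E ⊗[ℂ] F) : HTensor E F)) :=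
    HTensor.clm_ext fun x' y' => by
      simp only [ContinuousLinearMap.comp_apply, innerSL_apply_apply, opTensor_tmul,
        inner_coe_tmul, ContinuousLinearMap.star_eq_adjoint,
        ContinuousLinearMap.adjoint_inner_left]
  simpa using DFunLike.congr_fun key z

variable (F) in
/-- The ampliation `T ↦ T ⊗ I`. -/
def tensorOne : (E →L[ℂ] E) →⋆ₐ[ℂ] (HTensor E F →L[ℂ] HTensor E F) where
  toFun T := opTensor T 1
  map_one' := opTensor_one
  map_mul' S T := by rw [← opTensor_mul, one_mul]
  map_zero' := opTensor_zero_left 1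
  map_add' S T := opTensor_add_left S T 1
  commutes' c := by
    rw [Algebra.algebraMap_eq_smul_one, Algebra.algebraMap_eq_smul_one, opTensor_smul_left,
      opTensor_one]
  map_star' T := by rw [star_opTensor, star_one]

variable (E) in
/-- The ampliation `A ↦ I ⊗ A`. -/
def oneTensor : (F →L[ℂ] F) →⋆ₐ[ℂ] (HTensor E F →L[ℂ] HTensor E F) where
  toFun A := opTensor 1 A
  map_one' := opTensor_one
  map_mul' A B := by rw [← opTensor_mul, one_mul]
  map_zero' := opTensor_zero_right 1
  map_add' A B := opTensor_add_right 1 A B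
  commutes' c := by
    rw [Algebra.algebraMap_eq_smul_one, Algebra.algebraMap_eq_smul_one, opTensor_smul_right,
      opTensor_one]
  map_star' A := by rw [star_opTensor, star_one]

theorem tensorOne_apply (T : E →L[ℂ] E) : tensorOne F T = opTensor T 1 := rfl

theorem oneTensor_apply (A : F →L[ℂ] F) : oneTensor E A = opTensor 1 A := rfl

end TensorProducts

section Positivity

open scoped ComplexOrder

variable {E H : Type*} [NormedAddCommGroup E] [InnerProductSpace ℂ E]
  [NormedAddCommGroup H] [InnerProductSpace ℂ H]

theorem nonneg_iff_inner_nonneg {T : H →L[ℂ] H} : 0 ≤ T ↔ ∀ x, 0 ≤ inner ℂ x (T x) := by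
  rw [ContinuousLinearMap.nonneg_iff_isPositive]
  refine ⟨fun h => h.inner_nonneg_right, fun h => ?_⟩
  refine (ContinuousLinearMap.isPositive_iff_complex T).mpr fun x => ?_
  have hx := h x
  rw [← inner_conj_symm, starRingEnd_apply, star_nonneg_iff, Complex.nonneg_iff] at hx
  exact ⟨Complex.ext rfl hx.2, hx.1⟩

variable {ι : Type*} [Fintype ι]

theorem blockOp_nonneg_iff {M : Matrix ι ι (H →L[ℂ] H)} :
    0 ≤ blockOp M ↔ ∀ z : ι → H, 0 ≤ ∑ i, ∑ j, inner ℂ (z i) (M i j (z j)) := by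
  have hz (z : PiLp 2 fun _ : ι => H) :
      inner ℂ z (blockOp M z) = ∑ i, ∑ j, inner ℂ (z i) (M i j (z j)) := by
    simp only [PiLp.inner_apply, blockOp_apply, inner_sum]
  simp only [nonneg_iff_inner_nonneg, hz]
  exact (WithLp.equiv 2 (ι → H)).forall_congr_left

theorem apply_self_nonneg_of_blockOp_nonneg {M : Matrix ι ι (H →L[ℂ] H)} (hM : 0 ≤ blockOp M)
    (i : ι) : 0 ≤ M i i := by
  classical
  refine nonneg_iff_inner_nonneg.mpr fun x => ?_
  have h := blockOp_nonneg_iff.mp hM (Pi.single i x)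
  rw [Fintype.sum_eq_single i fun j hj => by simp [hj],
    Fintype.sum_eq_single i fun j hj => by simp [hj]] at h
  simpa only [Pi.single_eq_same] using h

theorem blockOp_nonneg_of_tendsto {κ : Type*} {l : Filter κ} [l.NeBot]
    {M : κ → Matrix ι ι (H →L[ℂ] H)} {N : Matrix ι ι (H →L[ℂ] H)}
    (hM : ∀ᶠ a in l, 0 ≤ blockOp (M a)) (hMN : Tendsto M l (𝓝 N)) : 0 ≤ blockOp N := by
  refine blockOp_nonneg_iff.mpr fun z => ?_
  have hz (i j : ι) : Tendsto (fun a => inner ℂ (z i) (M a i j (z j))) l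
      (𝓝 (inner ℂ (z i) (N i j (z j)))) :=
    ((innerSL ℂ (z i) ∘L ContinuousLinearMap.apply ℂ H (z j)).continuous.tendsto _).comp
      (tendsto_pi_nhds.mp (tendsto_pi_nhds.mp hMN i) j)
  exact ge_of_tendsto (tendsto_finsetSum _ fun i _ => tendsto_finsetSum _ fun j _ => hz i j)
    (hM.mono fun a ha => blockOp_nonneg_iff.mp ha z)

theorem blockOp_slice_nonneg [CompleteSpace H] {L : HTensor E H →L[ℂ] HTensor E H} (hL : 0 ≤ L)
    (ξ : ι → E) : 0 ≤ blockOp (Matrix.of fun i j => slice (ξ i) (ξ j) L) := by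
  refine blockOp_nonneg_iff.mpr fun z => ?_
  have h := nonneg_iff_inner_nonneg.mp hL (∑ i, tensorLeft (ξ i) (z i))
  rw [sum_inner] at h
  simpa only [map_sum, inner_sum, Matrix.of_apply, slice_apply, ContinuousLinearMap.comp_apply,
    ContinuousLinearMap.adjoint_inner_right] using h

end Positivity

section Creation

variable {n : ℕ}

theorem wordsOfLength_zero : wordsOfLength n 0 = {1} := by
  ext α
  rw [mem_wordsOfLength, FreeMonoid.length_eq_zero, Finset.mem_singleton]

theorem of_mul_inj {i j : Fin n} {α β : Words n} :
    FreeMonoid.of i * α = FreeMonoid.of j * β ↔ i = j ∧ α = β :=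
  List.cons_eq_cons

section WordProd

variable {X : Type*} [NormedAddCommGroup X] [InnerProductSpace ℂ X]

theorem wordProd_one (T : Fin n → X →L[ℂ] X) : wordProd T 1 = 1 := map_one _

theorem wordProd_of_mul (T : Fin n → X →L[ℂ] X) (i : Fin n) (α : Words n) :
    wordProd T (FreeMonoid.of i * α) = T i * wordProd T α := by
  rw [wordProd, map_mul, FreeMonoid.lift_eval_of, wordProd]

theorem wordProd_zero {α : Words n} (hα : α ≠ 1) :
    wordProd (0 : Fin n → X →L[ℂ] X) α = 0 := by
  cases α using FreeMonoid.casesOn with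
  | one => exact absurd rfl hα
  | of_mul i α => rw [wordProd_of_mul, Pi.zero_apply, zero_mul]

end WordProd

theorem inner_fockBasis (α β : Words n) :
    inner ℂ (fockBasis α) (fockBasis β) = if α = β then 1 else (0 : ℂ) :=
  orthonormal_iff_ite.mp (orthonormal_fockBasis n) α β

theorem fock_clm_ext_inner {S T : Fock n →L[ℂ] Fock n}
    (h : ∀ α β, inner ℂ (fockBasis α) (S (fockBasis β)) = inner ℂ (fockBasis α) (T (fockBasis β))) :
    S = T := by
  have hcoord (α : Words n) (z : Fock n) : inner ℂ (fockBasis α) z = z α := by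
    rw [fockBasis, lp.inner_single_left]
    simp
  refine lp.ext_continuousLinearMap (by norm_num) fun β => ?_
  ext α
  have hβ := h α β
  rw [hcoord, hcoord] at hβ
  exact hβ

theorem star_leftCreation_mul_leftCreation (i j : Fin n) :
    star (leftCreation i) * leftCreation j = if i = j then 1 else 0 := by
  refine fock_clm_ext_inner fun α β => ?_
  rw [mul_apply_eq_comp, ContinuousLinearMap.star_eq_adjoint,
    ContinuousLinearMap.adjoint_inner_right, leftCreation_fockBasis, leftCreation_fockBasis,
    inner_fockBasis]
  by_cases h : i = j <;> simp [h, of_mul_inj, inner_fockBasis]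

theorem star_wordProd_leftCreation_mul {α β : Words n} (h : α.length = β.length) :
    star (wordProd leftCreation α) * wordProd leftCreation β = if α = β then 1 else 0 := by
  induction α using FreeMonoid.inductionOn' generalizing β with
  | one =>
    have hβ : β = 1 := by simpa [eq_comm] using h
    simp [hβ, wordProd_one]
  | of_mul i α ih =>
    cases β using FreeMonoid.casesOn with
    | one => simp at h
    | of_mul j β =>
      have hl : α.length = β.length := by simpa using h
      calc star (wordProd leftCreation (FreeMonoid.of i * α)) *
              wordProd leftCreation (FreeMonoid.of j * β)
          = star (wordProd leftCreation α) * (star (leftCreation i) * leftCreation j) *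
              wordProd leftCreation β := by
            simp only [wordProd_of_mul, star_mul, mul_assoc]
        _ = if FreeMonoid.of i * α = FreeMonoid.of j * β then 1 else 0 := by
            rw [star_leftCreation_mul_leftCreation]
            by_cases hij : i = j <;> simp [hij, ih hl, of_mul_inj]

end Creation

section CreationModel

variable {n : ℕ} {X : Type*} [NormedAddCommGroup X] [InnerProductSpace ℂ X] [CompleteSpace X]

/-- The tuple `r S₁, …, r Sₙ` of scaled left creation operators, transported to a Hilbert space with
an orthonormal basis `b` indexed by the words, where `b α` plays the role of `e_α`. -/
def scaledCreation (b : HilbertBasis (Words n) ℂ X) (r : ℝ) (i : Fin n) : X →L[ℂ] X :=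
  (r : ℂ) • b.repr.symm.conjStarAlgEquiv (leftCreation i)

theorem inBall_scaledCreation (b : HilbertBasis (Words n) ℂ X) {r : ℝ} (hr : |r| < 1) :
    InBall (scaledCreation b r) := by
  let V (i : Fin n) : X →L[ℂ] X := b.repr.symm.conjStarAlgEquiv (leftCreation i)
  have hV (i j : Fin n) : star (V i) * V j = if i = j then 1 else 0 := by
    simp only [V, ← map_star, ← map_mul, star_leftCreation_mul_leftCreation]
    split_ifs <;> simp
  have hsum : ∑ i, scaledCreation b r i * star (scaledCreation b r i)
      = ((r : ℂ) * r) • ∑ i, V i * star (V i) := by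
    simp only [scaledCreation, Finset.smul_sum, star_smul, smul_mul_smul_comm, V,
      RCLike.star_def, Complex.conj_ofReal]
  calc ‖∑ i, scaledCreation b r i * star (scaledCreation b r i)‖
      = |r| * |r| * ‖∑ i, V i * star (V i)‖ := by
        rw [hsum, norm_smul, norm_mul, Complex.norm_real, Real.norm_eq_abs]
    _ ≤ |r| * |r| := mul_le_of_le_one_right (by positivity) (norm_sum_mul_star_le_one hV)
    _ < 1 := mul_lt_one_of_nonneg_of_lt_one_left (abs_nonneg r) hr hr.le

theorem wordProd_scaledCreation_apply (b : HilbertBasis (Words n) ℂ X) (r : ℝ) (α β : Words n) :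
    wordProd (scaledCreation b r) α (b β) = (r : ℂ) ^ α.length • b (α * β) := by
  have hcreate (i : Fin n) (γ : Words n) :
      scaledCreation b r i (b γ) = (r : ℂ) • b (FreeMonoid.of i * γ) := by
    have hb (δ : Words n) : b δ = b.repr.symm (fockBasis δ) := (b.repr_symm_single δ).symm
    simp [scaledCreation, hb, leftCreation_fockBasis]
  induction α using FreeMonoid.inductionOn' with
  | one => simp [wordProd_one]
  | of_mul i α ih =>
    rw [wordProd_of_mul, mul_apply_eq_comp, ih, map_smul, hcreate, smul_smul, ← pow_succ,
      FreeMonoid.length_mul, FreeMonoid.length_of, add_comm, mul_assoc]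

theorem inner_wordProd_scaledCreation (b : HilbertBasis (Words n) ℂ X) (r : ℝ) (μ α ν : Words n) :
    inner ℂ (b μ) (wordProd (scaledCreation b r) α (b ν))
      = if μ = α * ν then (r : ℂ) ^ α.length else 0 := by
  rw [wordProd_scaledCreation_apply, inner_smul_right, orthonormal_iff_ite.mp b.orthonormal]
  simp

variable (n) in
/-- A copy of the orthonormal basis `e_α` of the full Fock space in an arbitrary universe. -/
def liftedFockBasis : HilbertBasis (Words n) ℂ (lp (fun _ : ULift.{w} (Words n) => ℂ) 2) :=
  let b : HilbertBasis (ULift.{w} (Words n)) ℂ (lp (fun _ : ULift.{w} (Words n) => ℂ) 2) :=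
    .ofRepr (.refl ℂ _)
  .mk (b.orthonormal.comp _ ULift.up_injective) <| by
    rw [Set.range_comp, ULift.up_surjective.range_eq, Set.image_univ, b.dense_span]

end CreationModel

section Coefficients

variable {n : ℕ} {H : Type*} [NormedAddCommGroup H] [InnerProductSpace ℂ H] [CompleteSpace H]
  {X : Type*} [NormedAddCommGroup X] [InnerProductSpace ℂ X] {A : Words n → H →L[ℂ] H}

theorem slice_partialSum (T : Fin n → X →L[ℂ] X) (x x' : X) (m : ℕ) :
    slice x x' (partialSum A T m)
      = ∑ k ∈ Finset.range m, ∑ α ∈ wordsOfLength n k, inner ℂ x (wordProd T α x') • A α := by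
  simp only [partialSum, map_sum, slice_opTensor]

theorem slice_eq_inner_smul {T : Fin n → X →L[ℂ] X} {L : HTensor X H →L[ℂ] HTensor X H}
    (hL : Tendsto (partialSum A T) atTop (𝓝 L)) {x x' : X} (α : Words n)
    (hα : ∀ β ≠ α, inner ℂ x (wordProd T β x') = 0) :
    slice x x' L = inner ℂ x (wordProd T α x') • A α := by
  refine tendsto_nhds_unique (((slice x x').continuous.tendsto L).comp hL)
    (tendsto_const_nhds.congr' ?_)
  filter_upwards [eventually_gt_atTop α.length] with m hm
  rw [Function.comp_apply, slice_partialSum, Finset.sum_eq_single_of_mem α.length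
    (Finset.mem_range.mpr hm), Finset.sum_eq_single_of_mem α (mem_wordsOfLength.mpr rfl)]
  · intro β _ hβ
    rw [hα β hβ, zero_smul]
  · intro k _ hk
    refine Finset.sum_eq_zero fun β hβ => ?_
    rw [hα β (by rintro rfl; exact hk (mem_wordsOfLength.mp hβ).symm), zero_smul]

theorem coeff_one_nonneg (hA : IsHolomorphic.{w} A)
    (hA0 : ∀ (X : Type w) [NormedAddCommGroup X] [InnerProductSpace ℂ X] [CompleteSpace X],
      0 ≤ eval A (0 : Fin n → X →L[ℂ] X)) : 0 ≤ A 1 := by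
  let x : EuclideanSpace ℂ PUnit.{w + 1} := EuclideanSpace.single PUnit.unit 1
  have hx : inner ℂ x x = 1 := by simp [x]
  have hball : InBall (0 : Fin n → EuclideanSpace ℂ PUnit.{w + 1} →L[ℂ] _) := by simp [InBall]
  have h : slice x x (eval A 0) = A 1 := by
    rw [slice_eq_inner_smul (hA.tendsto_eval _ _ hball) 1 fun β hβ => by simp [wordProd_zero hβ],
      wordProd_one, one_apply_eq_self, hx, one_smul]
  exact h ▸ slice_self_nonneg x (hA0 _)

variable [CompleteSpace X] (b : HilbertBasis (Words n) ℂ X) {r : ℝ}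
  {L : HTensor X H →L[ℂ] HTensor X H}

theorem slice_of_length_le (hL : Tendsto (partialSum A (scaledCreation b r)) atTop (𝓝 L))
    {μ ν : Words n} (h : μ.length ≤ ν.length) :
    slice (b μ) (b ν) L = if μ = ν then A 1 else 0 := by
  rw [slice_eq_inner_smul hL 1, inner_wordProd_scaledCreation]
  · simp
  · intro β hβ
    rw [inner_wordProd_scaledCreation, if_neg]
    rintro rfl
    exact hβ (FreeMonoid.length_eq_zero.mp (by rw [FreeMonoid.length_mul] at h; omega))

theorem slice_one_right (hL : Tendsto (partialSum A (scaledCreation b r)) atTop (𝓝 L))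
    (α : Words n) : slice (b α) (b 1) L = (r : ℂ) ^ α.length • A α := by
  rw [slice_eq_inner_smul hL α, inner_wordProd_scaledCreation, mul_one, if_pos rfl]
  intro β hβ
  rw [inner_wordProd_scaledCreation, mul_one, if_neg hβ.symm]

-- The sign at the words of length `k` turns the off-diagonal entries `-A_α` of `2 - 2 Re L` into
-- those of `P_k`.
theorem matP_eq_slice (hL : Tendsto (partialSum A (scaledCreation b r)) atTop (𝓝 L))
    (hA : IsSelfAdjoint (A 1)) {k : ℕ} (hk : 1 ≤ k) :
    matP (fun α => (r : ℂ) ^ α.length • A α) k = Matrix.of fun i j =>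
      slice (Sum.elim (fun _ => b 1) (fun α : wordsOfLength n k => -b α) i)
        (Sum.elim (fun _ => b 1) (fun α : wordsOfLength n k => -b α) j)
        ((2 : ℂ) • 1 - (L + star L)) := by
  have hlen (α : wordsOfLength n k) : (α : Words n).length = k := mem_wordsOfLength.mp α.2
  have hne (α : wordsOfLength n k) : (α : Words n) ≠ 1 := by
    rw [Ne, ← FreeMonoid.length_eq_zero, hlen]
    omega
  have hb (μ ν : Words n) : inner ℂ (b μ) (b ν) = if μ = ν then (1 : ℂ) else 0 :=
    orthonormal_iff_ite.mp b.orthonormal μ ν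
  have hdiag (α β : wordsOfLength n k) :
      slice (b α) (b β) L = if α = β then A 1 else 0 := by
    rw [slice_of_length_le b hL (by rw [hlen, hlen])]
    simp only [Subtype.coe_inj]
  have hrow (α : wordsOfLength n k) : slice (b 1) (b α) L = 0 := by
    rw [slice_of_length_le b hL (Nat.zero_le _), if_neg (hne α).symm]
  ext1 i j
  rcases i with ⟨⟩ | α <;> rcases j with ⟨⟩ | β <;>
    simp only [matP, Matrix.fromBlocks_apply₁₁, Matrix.fromBlocks_apply₁₂,
      Matrix.fromBlocks_apply₂₁, Matrix.fromBlocks_apply₂₂, Matrix.of_apply, Sum.elim_inl,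
      Sum.elim_inr, slice_neg_left, slice_neg_right, slice_two_smul_one_sub, inner_neg_left,
      inner_neg_right, hb, FreeMonoid.length_one, pow_zero, one_smul, if_true]
  · rw [slice_of_length_le b hL le_rfl, if_pos rfl, hA.star_eq]
    module
  · simp [hrow, slice_one_right b hL, (hne β).symm]
  · simp [hrow, slice_one_right b hL, hne α]
  · rcases eq_or_ne α β with rfl | hαβ
    · simp only [hdiag, hA.star_eq, if_true, neg_neg, one_smul]
      module
    · simp [hdiag, hαβ, hαβ.symm]

theorem blockOp_matP_smul_nonneg (hA : IsHolomorphic.{w} A) (hA1 : IsSelfAdjoint (A 1))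
    (hARe : ∀ (X : Type w) [NormedAddCommGroup X] [InnerProductSpace ℂ X] [CompleteSpace X]
      (T : Fin n → X →L[ℂ] X), InBall T →
        (realPart (eval A T) : HTensor X H →L[ℂ] HTensor X H) ≤ 1)
    {k : ℕ} (hk : 1 ≤ k) (hr : |r| < 1) :
    0 ≤ blockOp (matP (fun α => (r : ℂ) ^ α.length • A α) k) := by
  have hball := inBall_scaledCreation (liftedFockBasis.{w} n) hr
  rw [matP_eq_slice _ (hA.tendsto_eval _ _ hball) hA1 hk]
  have hRe := hARe _ _ hball
  exact blockOp_slice_nonneg (two_smul_one_sub_nonneg_of_realPart_le_one hRe) _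

theorem blockOp_matP_nonneg (hA : IsHolomorphic.{w} A) (hA1 : IsSelfAdjoint (A 1))
    (hARe : ∀ (X : Type w) [NormedAddCommGroup X] [InnerProductSpace ℂ X] [CompleteSpace X]
      (T : Fin n → X →L[ℂ] X), InBall T →
        (realPart (eval A T) : HTensor X H →L[ℂ] HTensor X H) ≤ 1)
    {k : ℕ} (hk : 1 ≤ k) : 0 ≤ blockOp (matP A k) := by
  refine blockOp_nonneg_of_tendsto (l := 𝓝[<] (1 : ℝ))
    (M := fun r => matP (fun α => (r : ℂ) ^ α.length • A α) k) ?_ ?_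
  · filter_upwards [Ioo_mem_nhdsLT (show (-1 : ℝ) < 1 by norm_num)] with r hr
    exact blockOp_matP_smul_nonneg hA hA1 hARe hk (abs_lt.mpr hr)
  · have hcont : Continuous fun r : ℝ => matP (fun α => (r : ℂ) ^ α.length • A α) k := by
      refine .matrix_fromBlocks ?_ ?_ ?_ ?_ <;> refine continuous_matrix fun i j => ?_ <;>
        simp only [Matrix.of_apply]
      · fun_prop
      · fun_prop
      · fun_prop
      · split_ifs <;> fun_prop
    simpa using (hcont.tendsto 1).mono_left nhdsWithin_le_nhds

end Coefficients

section Domination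

variable {E : Type*} [NormedAddCommGroup E] [InnerProductSpace ℂ E]

/-- `T` is dominated by `B` when `2 Re ⟪y, T x⟫ ≤ ⟪x, B x⟫ + ⟪y, B y⟫`; for self-adjoint `B` this
says that the operator matrix with diagonal `(B, B)` and off-diagonal entries `-T*`, `-T` is
positive. -/
def IsDominatedBy (T B : E →L[ℂ] E) : Prop :=
  ∀ x y, 2 * (inner ℂ y (T x)).re ≤ (inner ℂ x (B x)).re + (inner ℂ y (B y)).re

namespace IsDominatedBy

variable {T B : E →L[ℂ] E}

theorem norm_le (h : IsDominatedBy T B) : ‖T‖ ≤ ‖B‖ := by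
  have hB {z : E} (hz : ‖z‖ = 1) : (inner ℂ z (B z)).re ≤ ‖B‖ :=
    calc (inner ℂ z (B z)).re ≤ ‖z‖ * ‖B z‖ := re_inner_le_norm (𝕜 := ℂ) z (B z)
      _ ≤ ‖z‖ * (‖B‖ * ‖z‖) := by gcongr; exact B.le_opNorm z
      _ = ‖B‖ := by rw [hz, mul_one, one_mul]
  refine T.opNorm_le_of_re_inner_le (norm_nonneg B) fun x y hx hy => ?_
  rw [inner_re_symm, RCLike.re_to_complex]
  linarith [h x y, hB hx, hB hy]

theorem of_norm_le {c : ℝ} (h : ‖T‖ ≤ c) : IsDominatedBy T ((c : ℂ) • 1) := by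
  intro x y
  have hc (z : E) : (inner ℂ z (((c : ℂ) • (1 : E →L[ℂ] E)) z)).re = c * ‖z‖ ^ 2 := by
    rw [smul_apply, one_apply_eq_self, inner_smul_right, Complex.re_ofReal_mul]
    exact congrArg (c * ·) (inner_self_eq_norm_sq (𝕜 := ℂ) z)
  have hT : (inner ℂ y (T x)).re ≤ c * (‖x‖ * ‖y‖) :=
    calc (inner ℂ y (T x)).re ≤ ‖y‖ * ‖T x‖ := re_inner_le_norm (𝕜 := ℂ) y (T x)
      _ ≤ ‖y‖ * (c * ‖x‖) := by gcongr; exact T.le_of_opNorm_le h x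
      _ = c * (‖x‖ * ‖y‖) := by ring
  have hsq : c * (2 * ‖x‖ * ‖y‖) ≤ c * (‖x‖ ^ 2 + ‖y‖ ^ 2) :=
    mul_le_mul_of_nonneg_left (two_mul_le_add_sq _ _) ((norm_nonneg T).trans h)
  rw [hc, hc]
  linarith

theorem add {T' B' : E →L[ℂ] E} (h : IsDominatedBy T B) (h' : IsDominatedBy T' B') :
    IsDominatedBy (T + T') (B + B') := by
  intro x y
  simp only [add_apply, inner_add_right, Complex.add_re]
  linarith [h x y, h' x y]

theorem sum {ι : Type*} {s : Finset ι} {T B : ι → E →L[ℂ] E}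
    (h : ∀ i ∈ s, IsDominatedBy (T i) (B i)) : IsDominatedBy (∑ i ∈ s, T i) (∑ i ∈ s, B i) := by
  intro x y
  simp only [sum_apply, inner_sum, Complex.re_sum, Finset.mul_sum, ← Finset.sum_add_distrib]
  exact Finset.sum_le_sum fun i hi => h i hi x y

theorem mono {B' : E →L[ℂ] E} (h : IsDominatedBy T B) (hB : B ≤ B') : IsDominatedBy T B' := by
  have hre (z : E) : (inner ℂ z (B z)).re ≤ (inner ℂ z (B' z)).re := by
    have hz := (ContinuousLinearMap.le_def B B').mp hB |>.re_inner_nonneg_right z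
    rw [sub_apply, inner_sub_right, map_sub] at hz
    exact sub_nonneg.mp hz
  exact fun x y => (h x y).trans (add_le_add (hre x) (hre y))

theorem of_tendsto {κ : Type*} {l : Filter κ} [l.NeBot] {B : κ → E →L[ℂ] E} {B₀ : E →L[ℂ] E}
    (h : ∀ᶠ a in l, IsDominatedBy T (B a)) (hB : Tendsto B l (𝓝 B₀)) : IsDominatedBy T B₀ := by
  intro x y
  have hre (z : E) : Tendsto (fun a => (inner ℂ z (B a z)).re) l (𝓝 (inner ℂ z (B₀ z)).re) :=
    ((Complex.reCLM.continuous.comp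
      (innerSL ℂ z ∘L ContinuousLinearMap.apply ℂ E z).continuous).tendsto B₀).comp hB
  exact ge_of_tendsto ((hre x).add (hre y)) (h.mono fun a ha => ha x y)

variable [CompleteSpace E]

theorem star_mul_mul (h : IsDominatedBy T B) (R : E →L[ℂ] E) :
    IsDominatedBy (star R * T * R) (star R * B * R) := by
  intro x y
  simp only [mul_apply_eq_comp, ContinuousLinearMap.star_eq_adjoint,
    ContinuousLinearMap.adjoint_inner_right]
  exact h (R x) (R y)

theorem map_mul_mul_map {H : Type*} [NormedAddCommGroup H] [InnerProductSpace ℂ H]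
    [CompleteSpace H] (Φ : (H →L[ℂ] H) →⋆ₐ[ℂ] (E →L[ℂ] E)) {D : H →L[ℂ] H}
    (hD : IsSelfAdjoint D) {c : ℝ} (hT : ‖T‖ ≤ c) :
    IsDominatedBy (Φ D * T * Φ D) ((c : ℂ) • Φ (D * D)) := by
  have h := (of_norm_le hT).star_mul_mul (Φ D)
  rwa [← map_star, hD.star_eq, mul_smul_comm, mul_one, smul_mul_assoc, ← map_mul] at h

theorem of_forall_pos_map_add {H : Type*} [NormedAddCommGroup H] [InnerProductSpace ℂ H]
    [CompleteSpace H] (Φ : (H →L[ℂ] H) →⋆ₐ[ℂ] (E →L[ℂ] E)) {B : H →L[ℂ] H} {c : ℝ}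
    (h : ∀ ε : ℝ, 0 < ε → IsDominatedBy T ((c : ℂ) • Φ (B + (ε : ℂ) • 1))) :
    IsDominatedBy T ((c : ℂ) • Φ B) := by
  refine of_tendsto (l := 𝓝[>] (0 : ℝ)) (eventually_mem_nhdsWithin.mono h) ?_
  have hcont : Continuous fun ε : ℝ => (c : ℂ) • (Φ B + (ε : ℂ) • 1) := by fun_prop
  simpa only [map_add, map_smul, map_one, Complex.ofReal_zero, zero_smul, add_zero]
    using (hcont.tendsto 0).mono_left nhdsWithin_le_nhds

theorem exists_factorization {D : E →L[ℂ] E} (hD : IsSelfAdjoint D) (hu : IsUnit D)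
    (h : IsDominatedBy T (D * D)) : ∃ G : E →L[ℂ] E, ‖G‖ ≤ 1 ∧ T = D * G * D := by
  obtain ⟨U, rfl⟩ := hu
  have hU : star U = U := Units.ext hD
  have hinv : star (↑U⁻¹ : E →L[ℂ] E) = ↑U⁻¹ := by rw [← Units.coe_star, star_inv, hU]
  have hG := (h.star_mul_mul ↑U⁻¹).norm_le
  simp only [hinv, mul_assoc, Units.mul_inv, Units.inv_mul_cancel_left] at hG
  exact ⟨↑U⁻¹ * T * ↑U⁻¹, by simpa only [mul_assoc] using hG.trans ContinuousLinearMap.norm_id_le,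
    by simp [mul_assoc]⟩

end IsDominatedBy

variable [CompleteSpace E]

theorem isDominatedBy_of_blockOp_nonneg {ι : Type*} [Fintype ι] {M : Matrix ι ι (E →L[ℂ] E)}
    {B : E →L[ℂ] E} (hM : 0 ≤ blockOp M) {i j : ι} (hij : i ≠ j)
    (hi : M i i = B) (hj : M j j = B) (hadj : M i j = star (M j i)) :
    IsDominatedBy (M j i) B := by
  classical
  intro x y
  let z : ι → E := Pi.single i x + Pi.single j (-y)
  have hzi : z i = x := by simp [z, hij]
  have hzj : z j = -y := by simp [z, hij.symm]
  have hz {l : ι} (hl : l ≠ i ∧ l ≠ j) : z l = 0 := by simp [z, hl]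
  have hsum := blockOp_nonneg_iff.mp hM z
  rw [Fintype.sum_eq_add i j hij fun l hl => by simp [hz hl],
    Fintype.sum_eq_add i j hij fun l hl => by simp [hz hl],
    Fintype.sum_eq_add i j hij fun l hl => by simp [hz hl], hzi, hzj, hi, hj, hadj] at hsum
  have hre : (inner ℂ x (star (M j i) y)).re = (inner ℂ y (M j i x)).re := by
    rw [ContinuousLinearMap.star_eq_adjoint, ContinuousLinearMap.adjoint_inner_right]
    exact inner_re_symm (𝕜 := ℂ) _ _
  have hnonneg := (Complex.nonneg_iff.mp hsum).1
  simp only [Complex.add_re, map_neg, inner_neg_left, inner_neg_right, Complex.neg_re, hre,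
    neg_neg] at hnonneg
  linarith

theorem star_sum_mul_sum {ι : Type*} {s : Finset ι} {T : ι → E →L[ℂ] E}
    (h : ∀ i ∈ s, ∀ j ∈ s, i ≠ j → star (T i) * T j = 0) :
    star (∑ i ∈ s, T i) * ∑ i ∈ s, T i = ∑ i ∈ s, star (T i) * T i := by
  rw [star_sum, Finset.sum_mul]
  refine Finset.sum_congr rfl fun i hi => ?_
  rw [Finset.mul_sum]
  exact Finset.sum_eq_single_of_mem i hi fun j hj hne => h i hi j hj hne.symm

theorem norm_le_sqrt_of_star_mul_self_le {T B : E →L[ℂ] E} (h : star T * T ≤ B) :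
    ‖T‖ ≤ √‖B‖ := by
  refine Real.le_sqrt_of_sq_le ?_
  rw [pow_two, ← CStarRing.norm_star_mul_self]
  exact CStarAlgebra.norm_le_norm_of_nonneg_of_le (star_mul_self_nonneg T) h

theorem norm_add_sum_le_one {P Q W : E →L[ℂ] E} {ι : Type*} {s : Finset ι} {T : ι → E →L[ℂ] E}
    {c : ι → ℝ} (hQ : 0 ≤ Q) (hPQ : P + ((1 / 2 : ℝ) : ℂ) • Q = 1) (hW : IsDominatedBy W P)
    (hT : ∀ i ∈ s, IsDominatedBy (T i) ((c i : ℂ) • Q)) (hc : ∑ i ∈ s, c i ≤ 1 / 2) :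
    ‖W + ∑ i ∈ s, T i‖ ≤ 1 := by
  have hle : P + ∑ i ∈ s, (c i : ℂ) • Q ≤ 1 := by
    simp only [← hPQ, Complex.coe_smul, ← Finset.sum_smul]
    gcongr
  exact ((hW.add (.sum hT)).mono hle).norm_le.trans ContinuousLinearMap.norm_id_le

theorem exists_tendsto_norm_le_of_summable {V : Type*} [NormedAddCommGroup V] {W : ℕ → V}
    (hW : Summable W) {M : ℝ} (h : ∀ m, ‖∑ k ∈ Finset.range (m + 1), W k‖ ≤ M) :
    ∃ L : V, Tendsto (fun m => ∑ k ∈ Finset.range m, W k) atTop (𝓝 L) ∧ ‖L‖ ≤ M := by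
  have ht := hW.hasSum.tendsto_sum_nat
  exact ⟨_, ht, le_of_tendsto' ((tendsto_add_atTop_iff_nat 1).mpr ht).norm h⟩

theorem summable_of_isDominatedBy {W : ℕ → E →L[ℂ] E} {Q : E →L[ℂ] E} {c : ℕ → ℝ}
    (hc0 : ∀ k, 0 ≤ c k) (hc : Summable c) (hW : ∀ k, IsDominatedBy (W k) ((c k : ℂ) • Q)) :
    Summable W := by
  refine .of_norm_bounded (hc.mul_right ‖Q‖) fun k => (hW k).norm_le.trans_eq ?_
  rw [norm_smul, Complex.norm_real, Real.norm_of_nonneg (hc0 k)]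

variable {H : Type*} [NormedAddCommGroup H] [InnerProductSpace ℂ H] [CompleteSpace H]

theorem exists_tendsto_sum_of_isDominatedBy (Φ : (H →L[ℂ] H) →⋆ₐ[ℂ] (E →L[ℂ] E))
    {B : H →L[ℂ] H} (hB : 0 ≤ (2 : ℂ) • (1 - B)) {W : ℕ → E →L[ℂ] E} {c : ℕ → ℝ}
    (hc0 : ∀ k, 0 ≤ c k) (hc : Summable c) (hc_le : ∑' k, c k ≤ 1 / 2)
    (hW0 : IsDominatedBy (W 0) (Φ B))
    (hW : ∀ k, IsDominatedBy (W (k + 1)) ((c k : ℂ) • Φ ((2 : ℂ) • (1 - B)))) :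
    ∃ L, Tendsto (fun m => ∑ k ∈ Finset.range m, W k) atTop (𝓝 L) ∧ ‖L‖ ≤ 1 := by
  have hone : Φ B + ((1 / 2 : ℝ) : ℂ) • Φ ((2 : ℂ) • (1 - B)) = 1 := by
    rw [map_smul, map_sub, map_one]
    push_cast
    module
  refine exists_tendsto_norm_le_of_summable
    ((summable_nat_add_iff 1).mp (summable_of_isDominatedBy hc0 hc hW)) fun m => ?_
  rw [Finset.sum_range_succ', add_comm]
  exact norm_add_sum_le_one (map_nonneg Φ hB) hone hW0 (fun k _ => hW k)
    ((hc.sum_le_tsum _ fun k _ => hc0 k).trans hc_le)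

end Domination

section OpTensorOrder

variable {E F : Type*} [NormedAddCommGroup E] [InnerProductSpace ℂ E] [CompleteSpace E]
  [NormedAddCommGroup F] [InnerProductSpace ℂ F] [CompleteSpace F]

theorem opTensor_star_mul_self_mono {S T : E →L[ℂ] E} (h : S ≤ T) (A : F →L[ℂ] F) :
    opTensor S (star A * A) ≤ opTensor T (star A * A) := by
  have hconj (R : E →L[ℂ] E) :
      opTensor R (star A * A) = star (oneTensor E A) * tensorOne F R * oneTensor E A := by
    rw [← map_star, oneTensor_apply, oneTensor_apply, tensorOne_apply, ← opTensor_mul,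
      ← opTensor_mul, one_mul, mul_one, mul_one]
  rw [hconj, hconj]
  exact star_left_conjugate_le_conjugate (OrderHomClass.mono (tensorOne F) h) _

theorem norm_oneTensor_le (A : F →L[ℂ] F) : ‖oneTensor E A‖ ≤ ‖A‖ :=
  NonUnitalStarAlgHom.norm_apply_le (oneTensor E) A

end OpTensorOrder

section HomogeneousPart

variable {n : ℕ} {H : Type*} [NormedAddCommGroup H] [InnerProductSpace ℂ H]
  {K : Type*} [NormedAddCommGroup K] [InnerProductSpace ℂ K]

/-- The homogeneous part `∑_{|α| = k} S_α ⊗ A_(α) ⊗ Y_(α)`. -/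
def homogeneousPart (A : Words n → H →L[ℂ] H) (Y : Words n → K →L[ℂ] K) (k : ℕ) :
    HTensor (HTensor (Fock n) H) K →L[ℂ] HTensor (HTensor (Fock n) H) K :=
  ∑ α ∈ wordsOfLength n k, opTensor (opTensor (wordProd leftCreation α) (A α)) (Y α)

variable [CompleteSpace H] [CompleteSpace K]

variable (n H K) in
/-- The ampliation `B ↦ I ⊗ B ⊗ I` to the space `F²(Hₙ) ⊗ H ⊗ K`. -/
def ampliation : (H →L[ℂ] H) →⋆ₐ[ℂ]
    (HTensor (HTensor (Fock n) H) K →L[ℂ] HTensor (HTensor (Fock n) H) K) :=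
  (tensorOne K).comp (oneTensor (Fock n))

theorem ampliation_apply (B : H →L[ℂ] H) : ampliation n H K B = opTensor (opTensor 1 B) 1 := rfl

theorem star_homogeneousPart_mul_homogeneousPart (G : Words n → H →L[ℂ] H)
    (Y : Words n → K →L[ℂ] K) (k : ℕ) :
    star (homogeneousPart G Y k) * homogeneousPart G Y k = ∑ α ∈ wordsOfLength n k,
      opTensor (oneTensor (Fock n) (star (G α) * G α)) (star (Y α) * Y α) := by
  have hmul (α β : Words n) (hα : α ∈ wordsOfLength n k) (hβ : β ∈ wordsOfLength n k) :
      star (opTensor (opTensor (wordProd leftCreation α) (G α)) (Y α))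
          * opTensor (opTensor (wordProd leftCreation β) (G β)) (Y β)
        = opTensor (opTensor (if α = β then 1 else 0) (star (G α) * G β)) (star (Y α) * Y β) := by
    rw [star_opTensor, star_opTensor, ← opTensor_mul, ← opTensor_mul,
      star_wordProd_leftCreation_mul
        ((mem_wordsOfLength.mp hα).trans (mem_wordsOfLength.mp hβ).symm)]
  rw [homogeneousPart, star_sum_mul_sum]
  · refine Finset.sum_congr rfl fun α hα => ?_
    rw [hmul α α hα hα, if_pos rfl, oneTensor_apply]
  · intro α hα β hβ hne
    rw [hmul α β hα hβ, if_neg hne, opTensor_zero_left, opTensor_zero_left]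

theorem norm_homogeneousPart_le {G : Words n → H →L[ℂ] H} {k : ℕ}
    (hG : ∀ α ∈ wordsOfLength n k, ‖G α‖ ≤ 1) (Y : Words n → K →L[ℂ] K) :
    ‖homogeneousPart G Y k‖ ≤ √‖∑ α ∈ wordsOfLength n k, star (Y α) * Y α‖ := by
  have hGG (α : Words n) (hα : α ∈ wordsOfLength n k) :
      oneTensor (Fock n) (star (G α) * G α) ≤ 1 := by
    rw [← map_one (oneTensor (Fock n))]
    refine OrderHomClass.mono (oneTensor (Fock n)) ?_
    rw [← CStarAlgebra.norm_le_one_iff_of_nonneg _ (star_mul_self_nonneg (G α)),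
      CStarRing.norm_star_mul_self]
    exact mul_le_one₀ (hG α hα) (norm_nonneg _) (hG α hα)
  have hle : star (homogeneousPart G Y k) * homogeneousPart G Y k
      ≤ oneTensor (HTensor (Fock n) H) (∑ α ∈ wordsOfLength n k, star (Y α) * Y α) := by
    rw [star_homogeneousPart_mul_homogeneousPart, map_sum]
    exact Finset.sum_le_sum fun α hα => opTensor_star_mul_self_mono (hGG α hα) (Y α)
  exact (norm_le_sqrt_of_star_mul_self_le hle).trans
    (Real.sqrt_le_sqrt (norm_oneTensor_le _))

theorem homogeneousPart_conj {A G : Words n → H →L[ℂ] H} {B C : H →L[ℂ] H} {k : ℕ}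
    (hAG : ∀ α ∈ wordsOfLength n k, A α = B * G α * C) (Y : Words n → K →L[ℂ] K) :
    homogeneousPart A Y k
      = ampliation n H K B * homogeneousPart G Y k * ampliation n H K C := by
  rw [homogeneousPart, homogeneousPart, Finset.mul_sum, Finset.sum_mul]
  refine Finset.sum_congr rfl fun α hα => ?_
  rw [ampliation_apply, ampliation_apply, ← opTensor_mul, ← opTensor_mul, ← opTensor_mul,
    ← opTensor_mul, hAG α hα, one_mul, mul_one, one_mul, mul_one]

theorem isDominatedBy_homogeneousPart_of_isUnit {A : Words n → H →L[ℂ] H} {D : H →L[ℂ] H}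
    (hD : IsSelfAdjoint D) (hu : IsUnit D) {k : ℕ}
    (hA : ∀ α ∈ wordsOfLength n k, IsDominatedBy (A α) (D * D)) (Y : Words n → K →L[ℂ] K) :
    IsDominatedBy (homogeneousPart A Y k)
      ((√‖∑ α ∈ wordsOfLength n k, star (Y α) * Y α‖ : ℂ) • ampliation n H K (D * D)) := by
  choose! G hG hAG using fun α hα => (hA α hα).exists_factorization hD hu
  rw [homogeneousPart_conj hAG]
  exact .map_mul_mul_map _ hD (norm_homogeneousPart_le hG Y)

theorem isDominatedBy_homogeneousPart {A : Words n → H →L[ℂ] H} {B : H →L[ℂ] H} (hB : 0 ≤ B)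
    {k : ℕ} (hA : ∀ α ∈ wordsOfLength n k, IsDominatedBy (A α) B) (Y : Words n → K →L[ℂ] K) :
    IsDominatedBy (homogeneousPart A Y k)
      ((√‖∑ α ∈ wordsOfLength n k, star (Y α) * Y α‖ : ℂ) • ampliation n H K B) := by
  refine .of_forall_pos_map_add _ fun ε hε => ?_
  have hBε : B ≤ B + (ε : ℂ) • 1 := le_add_of_nonneg_right (smul_one_nonneg hε.le)
  have hsqrt := CFC.sqrt_mul_sqrt_self (B + (ε : ℂ) • 1) (hB.trans hBε)
  rw [← hsqrt]
  refine isDominatedBy_homogeneousPart_of_isUnit (CFC.sqrt_nonneg _).isSelfAdjoint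
    ((CFC.isUnit_sqrt_iff _ (hB.trans hBε)).mpr (isUnit_add_smul_one hB hε)) (fun α hα => ?_) Y
  rw [hsqrt]
  exact (hA α hα).mono hBε

theorem isDominatedBy_homogeneousPart_zero {A : Words n → H →L[ℂ] H} (hA : 0 ≤ A 1)
    {Y : Words n → K →L[ℂ] K} (hY : ‖Y 1‖ ≤ 1) :
    IsDominatedBy (homogeneousPart A Y 0) (ampliation n H K (A 1)) := by
  have hR : IsSelfAdjoint (CFC.sqrt (A 1)) := (CFC.sqrt_nonneg (A 1)).isSelfAdjoint
  have hsqrt : CFC.sqrt (A 1) * CFC.sqrt (A 1) = A 1 := CFC.sqrt_mul_sqrt_self (A 1)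
  have hone : homogeneousPart (fun _ => (1 : H →L[ℂ] H)) Y 0
      = oneTensor (HTensor (Fock n) H) (Y 1) := by
    rw [homogeneousPart, wordsOfLength_zero, Finset.sum_singleton, wordProd_one, opTensor_one,
      oneTensor_apply]
  have hconj : homogeneousPart A Y 0 = ampliation n H K (CFC.sqrt (A 1)) *
      oneTensor (HTensor (Fock n) H) (Y 1) * ampliation n H K (CFC.sqrt (A 1)) := by
    rw [← hone]
    refine homogeneousPart_conj (fun α hα => ?_) Y
    rw [wordsOfLength_zero, Finset.mem_singleton] at hα
    rw [hα, mul_one, hsqrt]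
  have h := IsDominatedBy.map_mul_mul_map (ampliation n H K) hR
    ((norm_oneTensor_le (E := HTensor (Fock n) H) (Y 1)).trans hY)
  rwa [← hconj, Complex.ofReal_one, one_smul, hsqrt] at h

theorem two_smul_one_sub_nonneg_of_blockOp_matP_nonneg {A : Words n → H →L[ℂ] H} {k : ℕ}
    (h : 0 ≤ blockOp (matP A k)) : 0 ≤ (2 : ℂ) • (1 - A 1) :=
  apply_self_nonneg_of_blockOp_nonneg h (Sum.inl ())

theorem isDominatedBy_of_blockOp_matP_nonneg {A : Words n → H →L[ℂ] H} {k : ℕ}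
    (h : 0 ≤ blockOp (matP A k)) {α : Words n} (hα : α ∈ wordsOfLength n k) :
    IsDominatedBy (A α) ((2 : ℂ) • (1 - A 1)) :=
  isDominatedBy_of_blockOp_nonneg h (i := Sum.inl ()) (j := Sum.inr ⟨α, hα⟩) Sum.inl_ne_inr rfl
    (if_pos rfl) rfl

theorem exists_tendsto_sum_homogeneousPart {A : Words n → H →L[ℂ] H} (hpos : 0 ≤ A 1)
    (hP : ∀ k, 1 ≤ k → 0 ≤ blockOp (matP A k)) {Y : Words n → K →L[ℂ] K} (hY : ‖Y 1‖ ≤ 1)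
    (hs : Summable fun k : ℕ => √‖∑ α ∈ wordsOfLength n (k + 1), star (Y α) * Y α‖)
    (hs_le : ∑' k : ℕ, √‖∑ α ∈ wordsOfLength n (k + 1), star (Y α) * Y α‖ ≤ 1 / 2) :
    ∃ L, Tendsto (fun m : ℕ => ∑ k ∈ Finset.range m, homogeneousPart A Y k) atTop (𝓝 L) ∧
      ‖L‖ ≤ 1 := by
  have hΔ : 0 ≤ (2 : ℂ) • (1 - A 1) :=
    two_smul_one_sub_nonneg_of_blockOp_matP_nonneg (hP 1 le_rfl)
  exact exists_tendsto_sum_of_isDominatedBy (ampliation n H K) hΔ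
    (fun k => Real.sqrt_nonneg _) hs hs_le (isDominatedBy_homogeneousPart_zero hpos hY) fun k =>
      isDominatedBy_homogeneousPart hΔ
        (fun _ => isDominatedBy_of_blockOp_matP_nonneg (hP (k + 1) (Nat.le_add_left 1 k))) Y

end HomogeneousPart

end FreeHolo

end

theorem theorem2p4 (n : ℕ)
    {H : Type u} [NormedAddCommGroup H] [InnerProductSpace ℂ H] [CompleteSpace H]
    (A : FreeHolo.Words n → H →L[ℂ] H)
    (hA : FreeHolo.IsHolomorphic.{w} A)
    (hA0 : ∀ (X : Type w) [NormedAddCommGroup X] [InnerProductSpace ℂ X] [CompleteSpace X],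
      0 ≤ FreeHolo.eval A (0 : Fin n → X →L[ℂ] X))
    (hARe : ∀ (X : Type w) [NormedAddCommGroup X] [InnerProductSpace ℂ X] [CompleteSpace X]
      (T : Fin n → X →L[ℂ] X), FreeHolo.InBall T →
        (realPart (FreeHolo.eval A T) :
          FreeHolo.HTensor X H →L[ℂ] FreeHolo.HTensor X H) ≤ 1) :
    (∀ k : ℕ, 1 ≤ k → 0 ≤ FreeHolo.blockOp (FreeHolo.matP A k)) ∧
    (∀ {K : Type v} [NormedAddCommGroup K] [InnerProductSpace ℂ K] [CompleteSpace K]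
      (Y : FreeHolo.Words n → K →L[ℂ] K),
      ‖Y 1‖ ≤ 1 →
      Summable (fun k : ℕ =>
        √‖∑ α ∈ FreeHolo.wordsOfLength n (k + 1), star (Y α) * Y α‖) →
      ∑' k : ℕ, √‖∑ α ∈ FreeHolo.wordsOfLength n (k + 1), star (Y α) * Y α‖ ≤ 1 / 2 →
      ∃ L : FreeHolo.HTensor (FreeHolo.HTensor (FreeHolo.Fock n) H) K →L[ℂ]
          FreeHolo.HTensor (FreeHolo.HTensor (FreeHolo.Fock n) H) K,
        Tendsto (fun m : ℕ => ∑ k ∈ Finset.range m, ∑ α ∈ FreeHolo.wordsOfLength n k,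
          FreeHolo.opTensor
            (FreeHolo.opTensor (FreeHolo.wordProd FreeHolo.leftCreation α) (A α)) (Y α))
          atTop (𝓝 L) ∧ ‖L‖ ≤ 1) := by
  have hpos : 0 ≤ A 1 := FreeHolo.coeff_one_nonneg hA hA0
  have hP (k : ℕ) (hk : 1 ≤ k) : 0 ≤ FreeHolo.blockOp (FreeHolo.matP A k) :=
    FreeHolo.blockOp_matP_nonneg hA hpos.isSelfAdjoint hARe hk
  exact ⟨hP, fun Y hY hs hs_le =>
    FreeHolo.exists_tendsto_sum_homogeneousPart hpos hP hY hs hs_le⟩
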